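/- Let $K$ be a compact metric space. A function $f:K\to\mathbb R$ is Baire-1 if it is the pointwise limit of a sequence of continuous real-valued functions on $K$. For $f:K\to\mathbb R$ and $\varepsilon>0$ put $K^0(f,\varepsilon)=K$; let $K^{\alpha+1}(f,\varepsilon)$ be the set of all $x\in K^\alpha(f,\varepsilon)$ such that every open set $U\ni x$ contains two points $x_1,x_2\in U\cap K^\alpha(f,\varepsilon)$ with $|f(x_1)-f(x_2)|\ge\varepsilon$; and let $K^\alpha(f,\varepsilon)=\bigcap_{\alpha'<\alpha}K^{\alpha'}(f,\varepsilon)$ for countable limit ordinals $\alpha$. Let $\beta(f,\varepsilon)$ be the least countable ordinal $\alpha$ with $K^\alpha(f,\varepsilon)=\emptyset$ if one exists, and $\omega_1$ otherwise. The oscillation index of $f$ is $\beta(f)=\sup_{\varepsilon>0}\beta(f,\varepsilon)$. For a sequence $(f_n)$ of real-valued functions on $K$ and $\varepsilon>0$, define $K^\alpha((f_n),\varepsilon)$ in the same way, except that $K^{\alpha+1}((f_n),\varepsilon)$ is the set of all $x\in K^\alpha((f_n),\varepsilon)$ such that for every open set $U\ni x$ and every $m\in\mathbb N$ there are integers $n_1>n_2>m$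 and a point $x'\in U\cap K^\alpha((f_n),\varepsilon)$ with $|f_{n_1}(x')-f_{n_2}(x')|\ge\varepsilon$. Let $\gamma((f_n),\varepsilon)$ be the least countable ordinal $\alpha$ with $K^\alpha((f_n),\varepsilon)=\emptyset$ if one exists, and $\omega_1$ otherwise. The convergence index is $\gamma((f_n))=\sup_{\varepsilon>0}\gamma((f_n),\varepsilon)$. **Theorem.** Let $f:K\to\mathbb R$ be a Baire-1 function, and suppose that $\beta(f)\le\beta_0\cdot\omega^{\gamma_0}$ for some ordinals $1\le\beta_0<\omega_1$ and $\gamma_0<\omega_1$. Then there is a sequence $(f_n)$ of Baire-1 functions on $K$ that converges pointwise to $f$ such that $\beta(f_n)\le\beta_0$ for all $n\in\mathbb N$ and $\gamma((f_n))\le\omega^{\gamma_0}$. -/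

import Mathlib

open Filter Topology
open scoped Ordinal

namespace BaireIndex

/-- `f` is of Baire class one: a pointwise limit of a sequence of real-valued continuous
functions. -/
def IsBaireOne {X : Type*} [TopologicalSpace X] (f : X → ℝ) : Prop :=
  ∃ g : ℕ → X → ℝ, (∀ n, Continuous (g n)) ∧ ∀ x, Tendsto (fun n => g n x) atTop (𝓝 (f x))

/-- The transfinite iteration of a set operation `D`, starting from `H`: apply `D` at successor
steps and take intersections at limit steps. -/
noncomputable def iterDeriv {X : Type*} (D : Set X → Set X) (H : Set X) (α : Ordinal.{0}) :
    Set X :=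
  Ordinal.limitRecOn (motive := fun _ => Set X) α H (fun _ P => D P)
    (fun lam _ P => ⋂ (α' : Ordinal.{0}) (h : α' < lam), P α' h)

theorem iterDeriv_zero {X : Type*} (D : Set X → Set X) (H : Set X) :
    iterDeriv D H 0 = H := by
  simp [iterDeriv]

theorem iterDeriv_add_one {X : Type*} (D : Set X → Set X) (H : Set X) (α : Ordinal.{0}) :
    iterDeriv D H (α + 1) = D (iterDeriv D H α) := by
  simp [iterDeriv]

theorem iterDeriv_limit {X : Type*} (D : Set X → Set X) (H : Set X) {α : Ordinal.{0}}
    (hα : Order.IsSuccLimit α) :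
    iterDeriv D H α = ⋂ (α' : Ordinal.{0}) (_ : α' < α), iterDeriv D H α' := by
  unfold iterDeriv
  exact Ordinal.limitRecOn_limit _ _ _ _ hα

open scoped Classical in
/-- The least ordinal `α < ω₁` at which the iteration of `D` from `H` becomes empty, and `ω₁` if
there is no such ordinal. -/
noncomputable def rank {X : Type*} (D : Set X → Set X) (H : Set X) : Ordinal.{0} :=
  if ∃ α < ω₁, iterDeriv D H α = ∅ then sInf {α : Ordinal.{0} | iterDeriv D H α = ∅} else ω₁

theorem rank_le_omega_one {X : Type*} (D : Set X → Set X) (H : Set X) : rank D H ≤ ω₁ := by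
  unfold rank
  split_ifs with h
  · obtain ⟨α, hα, h0⟩ := h
    exact (csInf_le' (show α ∈ {α : Ordinal.{0} | iterDeriv D H α = ∅} from h0)).trans hα.le
  · exact le_rfl

/-- The oscillation derivative: `x ∈ P` stays if in every open `U ∋ x` there are two points of
`U ∩ P` at which the values of `f` differ by at least `ε`. -/
def oscStep {X : Type*} [TopologicalSpace X] (f : X → ℝ) (ε : ℝ) (P : Set X) : Set X :=
  {x | x ∈ P ∧ ∀ U : Set X, IsOpen U → x ∈ U →
    ∃ x₁ ∈ U ∩ P, ∃ x₂ ∈ U ∩ P, ε ≤ |f x₁ - f x₂|}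

/-- The convergence derivative: `x ∈ P` stays if for every open `U ∋ x` and every `m` there are
`n₁ > n₂ > m` and a point of `U ∩ P` at which `f n₁` and `f n₂` differ by at least `ε`. -/
def convStep {X : Type*} [TopologicalSpace X] (f : ℕ → X → ℝ) (ε : ℝ) (P : Set X) : Set X :=
  {x | x ∈ P ∧ ∀ U : Set X, IsOpen U → x ∈ U → ∀ m : ℕ,
    ∃ n₁ n₂ : ℕ, n₁ > n₂ ∧ n₂ > m ∧ ∃ x' ∈ U ∩ P, ε ≤ |f n₁ x' - f n₂ x'|}

/-- The oscillation index `β_H(f)`, the supremum of `β_H(f, ε)` over all `ε > 0`. -/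
noncomputable def oscIndex {X : Type*} [TopologicalSpace X] (H : Set X) (f : X → ℝ) :
    Ordinal.{0} :=
  ⨆ ε : {ε : ℝ // 0 < ε}, rank (oscStep f ε) H

/-- The convergence index `γ_H((f_n))`, the supremum of `γ_H((f_n), ε)` over all `ε > 0`. -/
noncomputable def convIndex {X : Type*} [TopologicalSpace X] (H : Set X) (f : ℕ → X → ℝ) :
    Ordinal.{0} :=
  ⨆ ε : {ε : ℝ // 0 < ε}, rank (convStep f ε) H

/-- The supremum defining the oscillation index is over a bounded family, so it is a genuine
supremum. -/
theorem oscIndex_le_iff {X : Type*} [TopologicalSpace X] (H : Set X) (f : X → ℝ)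
    (α : Ordinal.{0}) : oscIndex H f ≤ α ↔ ∀ ε : ℝ, 0 < ε → rank (oscStep f ε) H ≤ α := by
  unfold oscIndex
  rw [ciSup_le_iff' ⟨ω₁, by rintro _ ⟨ε, rfl⟩; exact rank_le_omega_one _ _⟩]
  exact Subtype.forall

/-- The supremum defining the convergence index is over a bounded family, so it is a genuine
supremum. -/
theorem convIndex_le_iff {X : Type*} [TopologicalSpace X] (H : Set X) (f : ℕ → X → ℝ)
    (α : Ordinal.{0}) : convIndex H f ≤ α ↔ ∀ ε : ℝ, 0 < ε → rank (convStep f ε) H ≤ α := by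
  unfold convIndex
  rw [ciSup_le_iff' ⟨ω₁, by rintro _ ⟨ε, rfl⟩; exact rank_le_omega_one _ _⟩]
  exact Subtype.forall

end BaireIndex

/-! For `ε = 1/(k+1)`, the derived sets of `f` give an upper semicontinuous rank `ρ k < ω^ξ * ω^γ₀`,
`ξ = log ω β₀`, on whose level sets `f` is locally `ε`-close to its central value. Divide `ρ k` by
`ω^ξ`: the quotient, below `ω^γ₀`, governs convergence; the remainder, below `ω^ξ ≤ β₀`, governs the
oscillation of the approximants.

Where the quotient is maximal over `δ`-balls it is locally constant, so there the remainder is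
itself a rank (`isUpperRank_stableMod`). Natural sums merge finitely many remainders into one rank,
still below `ω^ξ` (`natSum_lt_omega0_opow`). On each of its levels a partition of unity gives a
continuous function close to `f` on the stable sets (`exists_approx_on_stableSets`). With `δ =
1/(n+1)`, nearby points of equal quotient are all stable from some `n` on
(`mem_stableSet_of_eventually`), which bounds the convergence index. -/

namespace BaireIndex

/-! ### The natural sum of ordinals -/

/-- The least function of two ordinals that is strictly increasing in each argument. -/
noncomputable def natSum (a b : Ordinal.{0}) : Ordinal.{0} :=
  max (⨆ x : Set.Iio a, Order.succ (natSum x.1 b)) (⨆ y : Set.Iio b, Order.succ (natSum a y.1))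
termination_by (a, b)
decreasing_by
  · exact Prod.Lex.left _ _ x.2
  · exact Prod.Lex.right _ y.2

theorem natSum_lt_left {a a' : Ordinal.{0}} (b : Ordinal.{0}) (h : a' < a) :
    natSum a' b < natSum a b := by
  rw [natSum.eq_1 a b]
  refine lt_max_of_lt_left (Order.lt_succ _ |>.trans_le ?_)
  exact Ordinal.le_iSup (fun x : Set.Iio a => Order.succ (natSum x.1 b)) ⟨a', h⟩

theorem natSum_lt_right (a : Ordinal.{0}) {b b' : Ordinal.{0}} (h : b' < b) :
    natSum a b' < natSum a b := by
  rw [natSum.eq_1 a b]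
  refine lt_max_of_lt_right (Order.lt_succ _ |>.trans_le ?_)
  exact Ordinal.le_iSup (fun y : Set.Iio b => Order.succ (natSum a y.1)) ⟨b', h⟩

theorem natSum_le_of_forall_lt {a b c : Ordinal.{0}} (h₁ : ∀ a' < a, natSum a' b < c)
    (h₂ : ∀ b' < b, natSum a b' < c) : natSum a b ≤ c := by
  rw [natSum.eq_1 a b]
  exact max_le (Ordinal.iSup_le fun x => Order.succ_le_of_lt (h₁ _ x.2))
    (Ordinal.iSup_le fun y => Order.succ_le_of_lt (h₂ _ y.2))

theorem natSum_mono {a a' b b' : Ordinal.{0}} (ha : a' ≤ a) (hb : b' ≤ b) :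
    natSum a' b' ≤ natSum a b := by
  have h₁ : natSum a' b' ≤ natSum a b' :=
    (show StrictMono fun x => natSum x b' from fun _ _ h => natSum_lt_left b' h).monotone ha
  have h₂ : natSum a b' ≤ natSum a b :=
    (show StrictMono fun x => natSum a x from fun _ _ h => natSum_lt_right a h).monotone hb
  exact h₁.trans h₂

theorem eq_of_natSum_eq {a a' b b' : Ordinal.{0}} (ha : a' ≤ a) (hb : b' ≤ b)
    (h : natSum a' b' = natSum a b) : a' = a ∧ b' = b := by
  constructor
  · refine ha.eq_of_not_lt fun hlt => ?_
    exact ((natSum_lt_left b' hlt).trans_le (natSum_mono le_rfl hb)).ne h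
  · refine hb.eq_of_not_lt fun hlt => ?_
    exact ((natSum_lt_right a' hlt).trans_le (natSum_mono ha le_rfl)).ne h

/-- Lowering one argument lowers either its coefficient of `ω^c`, and the freed `ω^c` absorbs the
natural sum of the remainders by `hc`, or only its remainder. -/
theorem natSum_le_opow_mul_add {c : Ordinal.{0}}
    (hc : ∀ a < ω ^ c, ∀ b < ω ^ c, natSum a b < ω ^ c) (a b : Ordinal.{0}) :
    ∀ (k l : ℕ) (a' b' : Ordinal.{0}), a' < ω ^ c → b' < ω ^ c →
      a = ω ^ c * k + a' → b = ω ^ c * l + b' →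
      natSum a b ≤ ω ^ c * ((k + l : ℕ) : Ordinal) + natSum a' b' := by
  have hpos : (ω : Ordinal.{0}) ^ c ≠ 0 := Ordinal.opow_ne_zero _ Ordinal.omega0_ne_zero
  have key : ∀ (x k a' : Ordinal.{0}), a' < ω ^ c → x < ω ^ c * k + a' → k < ω →
      ∃ (j : ℕ) (y : Ordinal.{0}), y < ω ^ c ∧ x = ω ^ c * j + y ∧
        ((j : Ordinal) < k ∨ ((j : Ordinal) = k ∧ y < a')) := by
    intro x k a' ha' hx hk
    have hle : x / ω ^ c ≤ k := by
      rw [← Order.lt_succ_iff, ← Ordinal.lt_mul_iff_div_lt hpos, Order.succ_eq_add_one, mul_add_one]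
      exact hx.trans (by gcongr)
    obtain ⟨j, hj⟩ := Ordinal.lt_omega0.1 (hle.trans_lt hk)
    refine ⟨j, x % ω ^ c, Ordinal.mod_lt _ hpos, ?_, ?_⟩
    · rw [← hj, Ordinal.div_add_mod]
    · rcases hle.lt_or_eq with h | h
      · exact Or.inl (hj ▸ h)
      · refine Or.inr ⟨hj ▸ h, ?_⟩
        rw [← Ordinal.div_add_mod x (ω ^ c), h] at hx
        exact lt_of_add_lt_add_left hx
  induction a using WellFoundedLT.induction generalizing b with
  | ind a iha =>
  induction b using WellFoundedLT.induction with
  | ind b ihb =>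
  intro k l a' b' ha' hb' ha hb
  have step : ∀ (i m : ℕ) (y z : Ordinal.{0}), y < ω ^ c → z < ω ^ c → i < m →
      ω ^ c * (i : Ordinal) + natSum y z < ω ^ c * (m : Ordinal) + natSum a' b' := by
    intro i m y z hy hz him
    calc ω ^ c * (i : Ordinal) + natSum y z < ω ^ c * (i : Ordinal) + ω ^ c := by
          gcongr; exact hc _ hy _ hz
      _ = ω ^ c * ((i + 1 : ℕ) : Ordinal) := by push_cast; rw [mul_add_one]
      _ ≤ ω ^ c * (m : Ordinal) := by gcongr; exact him
      _ ≤ _ := le_self_add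
  refine natSum_le_of_forall_lt (fun x hx => ?_) fun x hx => ?_
  · obtain ⟨j, y, hy, hxy, hcase⟩ := key x k a' ha' (ha ▸ hx) (Ordinal.natCast_lt_omega0 k)
    refine (iha x hx b j l y b' hy hb' hxy hb).trans_lt ?_
    rcases hcase with h | ⟨h, h'⟩
    · exact step _ _ _ _ hy hb' (by have : j < k := by exact_mod_cast h
                                    omega)
    · have : j = k := by exact_mod_cast h
      subst this
      gcongr
      exact natSum_lt_left _ h'
  · obtain ⟨j, y, hy, hxy, hcase⟩ := key x l b' hb' (hb ▸ hx) (Ordinal.natCast_lt_omega0 l)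
    refine (ihb x hx k j a' y ha' hy ha hxy).trans_lt ?_
    rcases hcase with h | ⟨h, h'⟩
    · exact step _ _ _ _ ha' hy (by have : j < l := by exact_mod_cast h
                                    omega)
    · have : j = l := by exact_mod_cast h
      subst this
      gcongr
      exact natSum_lt_right _ h'

theorem natSum_lt_omega0_opow (c : Ordinal.{0}) :
    ∀ a < ω ^ c, ∀ b < ω ^ c, natSum a b < ω ^ c := by
  induction c using WellFoundedLT.induction with
  | ind c ih =>
  intro a ha b hb
  rcases eq_or_ne c 0 with rfl | hc
  · simp only [Ordinal.opow_zero, Order.lt_one_iff] at *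
    subst ha hb
    refine le_antisymm (natSum_le_of_forall_lt ?_ ?_) bot_le <;>
      exact fun x hx => absurd hx not_lt_bot
  obtain ⟨d₁, hd₁, n₁, hn₁⟩ := (Ordinal.lt_omega0_opow hc).1 ha
  obtain ⟨d₂, hd₂, n₂, hn₂⟩ := (Ordinal.lt_omega0_opow hc).1 hb
  obtain ⟨d, hd, h₁, h₂⟩ : ∃ d < c, d₁ ≤ d ∧ d₂ ≤ d :=
    ⟨max d₁ d₂, max_lt hd₁ hd₂, le_max_left _ _, le_max_right _ _⟩
  have hpos : (ω : Ordinal.{0}) ^ d ≠ 0 := Ordinal.opow_ne_zero _ Ordinal.omega0_ne_zero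
  have quot : ∀ (x e : Ordinal.{0}) (n : ℕ), e ≤ d → x < ω ^ e * n →
      ∃ j : ℕ, x = ω ^ d * j + x % ω ^ d := by
    intro x e n he hx
    have : x / ω ^ d < ω := by
      refine lt_of_lt_of_le ((Ordinal.lt_mul_iff_div_lt hpos).1 (hx.trans_le ?_))
        (Ordinal.natCast_lt_omega0 n).le
      gcongr
      exact Ordinal.omega0_pos
    obtain ⟨j, hj⟩ := Ordinal.lt_omega0.1 this
    exact ⟨j, by rw [← hj, Ordinal.div_add_mod]⟩
  obtain ⟨k, hk⟩ := quot a d₁ n₁ h₁ hn₁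
  obtain ⟨l, hl⟩ := quot b d₂ n₂ h₂ hn₂
  have hma := Ordinal.mod_lt a hpos
  have hmb := Ordinal.mod_lt b hpos
  refine (natSum_le_opow_mul_add (ih d hd) a b k l _ _ hma hmb hk hl).trans_lt ?_
  -- The extra `+ 1` makes room for the natural sum of the remainders.
  refine lt_trans ?_ (Ordinal.opow_mul_lt_opow (Ordinal.natCast_lt_omega0 (k + l + 1)) hd)
  rw [Nat.cast_add_one, mul_add_one]
  gcongr
  exact ih d hd _ hma _ hmb

/-! ### Ordinal ranks on a topological space -/

/-- An ordinal-valued function that is upper semicontinuous. -/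
def IsUpperRank {X : Type*} [TopologicalSpace X] (ρ : X → Ordinal.{0}) : Prop :=
  ∀ x, ∀ᶠ y in 𝓝 x, ρ y ≤ ρ x

/-- Within each level set of `ρ`, the values of `f` near a point `x` are `ε`-close to `f x`. -/
def LevelOscLT {X : Type*} [TopologicalSpace X] (ρ : X → Ordinal.{0}) (f : X → ℝ) (ε : ℝ) :
    Prop :=
  ∀ x, ∀ᶠ y in 𝓝 x, ρ y = ρ x → |f y - f x| < ε

theorem IsUpperRank.div {X : Type*} [TopologicalSpace X] {ρ : X → Ordinal.{0}}
    (h : IsUpperRank ρ) (c : Ordinal.{0}) : IsUpperRank fun x => ρ x / c :=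
  fun x => (h x).mono fun _ hy => Ordinal.div_le_left hy c

/-! ### Derivations and ranks -/

theorem iterDeriv_anti {X : Type*} {D : Set X → Set X} (hD : ∀ P, D P ⊆ P) (H : Set X)
    {α β : Ordinal.{0}} (h : α ≤ β) : iterDeriv D H β ⊆ iterDeriv D H α := by
  induction β using Ordinal.limitRecOn with
  | zero => rw [nonpos_iff_eq_zero.1 h]
  | add_one β ih =>
    rcases h.lt_or_eq with h | rfl
    · rw [← Order.succ_eq_add_one, Order.lt_succ_iff] at h
      rw [iterDeriv_add_one]
      exact (hD _).trans (ih h)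
    · exact subset_rfl
  | limit β hβ ih =>
    rcases h.lt_or_eq with h | rfl
    · rw [iterDeriv_limit _ _ hβ]
      exact Set.biInter_subset_of_mem (t := fun α' => iterDeriv D H α') h
    · exact subset_rfl

theorem isClosed_iterDeriv {X : Type*} [TopologicalSpace X] {D : Set X → Set X}
    (hD : ∀ P, IsClosed P → IsClosed (D P)) {H : Set X} (hH : IsClosed H) (α : Ordinal.{0}) :
    IsClosed (iterDeriv D H α) := by
  induction α using Ordinal.limitRecOn with
  | zero => rwa [iterDeriv_zero]
  | add_one α ih => rw [iterDeriv_add_one]; exact hD _ ih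
  | limit α hα ih =>
    rw [iterDeriv_limit _ _ hα]
    exact isClosed_biInter fun i hi => ih i hi

theorem rank_le_of_iterDeriv_eq_empty {X : Type*} {D : Set X → Set X} {H : Set X}
    {α : Ordinal.{0}} (hα : α < ω₁) (h : iterDeriv D H α = ∅) : rank D H ≤ α := by
  unfold rank
  rw [if_pos ⟨α, hα, h⟩]
  exact csInf_le' h

theorem iterDeriv_eq_empty_of_rank_le {X : Type*} {D : Set X → Set X} (hD : ∀ P, D P ⊆ P)
    {H : Set X} {α : Ordinal.{0}} (hα : α < ω₁) (h : rank D H ≤ α) : iterDeriv D H α = ∅ := by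
  unfold rank at h
  split_ifs at h with hex
  · obtain ⟨β, -, hβ⟩ := hex
    have h0 : iterDeriv D H (sInf {α : Ordinal.{0} | iterDeriv D H α = ∅}) = ∅ :=
      csInf_mem (s := {α : Ordinal.{0} | iterDeriv D H α = ∅}) ⟨β, hβ⟩
    exact Set.subset_eq_empty (iterDeriv_anti hD H h) h0
  · exact absurd hα h.not_gt

/-- If a derivation of `P` removes every point of `P` at which `ρ` takes its least value on `P`,
then its rank is bounded by any bound of `ρ`. -/
theorem rank_le_of_rank_function {X : Type*} {D : Set X → Set X}
    (ρ : X → Ordinal.{0}) {α : Ordinal.{0}} (hα : α < ω₁) (hρ : ∀ x, ρ x < α)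
    (h : ∀ P, ∀ x ∈ D P, ∃ y ∈ P, ρ y < ρ x) : rank D Set.univ ≤ α := by
  have key : ∀ σ : Ordinal.{0}, ∀ x ∈ iterDeriv D Set.univ σ, σ ≤ ρ x := by
    intro σ
    induction σ using Ordinal.limitRecOn with
    | zero => exact fun x _ => bot_le
    | add_one σ ih =>
      intro x hx
      rw [iterDeriv_add_one] at hx
      obtain ⟨y, hy, hlt⟩ := h _ x hx
      exact Order.add_one_le_of_lt ((ih y hy).trans_lt hlt)
    | limit σ hσ ih =>
      intro x hx
      rw [iterDeriv_limit _ _ hσ] at hx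
      exact (hσ.le_iff_forall_le).2 fun τ hτ => ih τ hτ x (Set.mem_iInter₂.1 hx τ hτ)
  refine rank_le_of_iterDeriv_eq_empty hα (Set.eq_empty_of_forall_notMem fun x hx => ?_)
  exact (hρ x).not_ge (key α x hx)

theorem oscStep_subset {X : Type*} [TopologicalSpace X] (f : X → ℝ) (ε : ℝ) (P : Set X) :
    oscStep f ε P ⊆ P := fun _ h => h.1

theorem isClosed_oscStep {X : Type*} [TopologicalSpace X] (f : X → ℝ) (ε : ℝ) (P : Set X)
    (hP : IsClosed P) : IsClosed (oscStep f ε P) := by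
  rw [← isOpen_compl_iff, isOpen_iff_forall_mem_open]
  intro x hx
  by_cases hxP : x ∈ P
  · simp only [oscStep, Set.mem_compl_iff, Set.mem_ofPred_eq, not_and, not_forall] at hx
    obtain ⟨U, hU, hxU, hne⟩ := hx hxP
    exact ⟨U, fun y hy hy' => hne (hy'.2 U hU hy), hU, hxU⟩
  · exact ⟨Pᶜ, fun y hy hy' => hy hy'.1, hP.isOpen_compl, hxP⟩

/-- Limit stages are intersections, so a point can only be lost at a successor stage. -/
theorem exists_rank_of_iterDeriv_eq_empty {X : Type*} {D : Set X → Set X}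
    {α : Ordinal.{0}} (h : iterDeriv D Set.univ α = ∅) (x : X) :
    ∃ β < α, x ∈ iterDeriv D Set.univ β ∧ x ∉ iterDeriv D Set.univ (β + 1) := by
  have hx : x ∉ iterDeriv D Set.univ α := by simp [h]
  by_contra! hcon
  have key : ∀ σ ≤ α, x ∈ iterDeriv D Set.univ σ := by
    intro σ
    induction σ using Ordinal.limitRecOn with
    | zero => exact fun _ => by simp [iterDeriv_zero]
    | add_one σ ih =>
      intro hσ
      have hlt : σ < α := Order.add_one_le_iff.1 hσ
      exact hcon σ hlt (ih hlt.le)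
    | limit σ hσ ih =>
      intro hle
      rw [iterDeriv_limit _ _ hσ]
      exact Set.mem_iInter₂.2 fun τ hτ => ih τ hτ (hτ.le.trans hle)
  exact hx (key α le_rfl)

/-- The rank of a point is the stage whose derivation removes it; semicontinuity is closedness of
the derived sets. -/
theorem exists_isUpperRank_of_rank_oscStep_le {X : Type*} [TopologicalSpace X] {f : X → ℝ}
    {ε : ℝ} {α : Ordinal.{0}} (hα : α < ω₁) (h : rank (oscStep f ε) Set.univ ≤ α) :
    ∃ ρ : X → Ordinal.{0}, IsUpperRank ρ ∧ (∀ x, ρ x < α) ∧ LevelOscLT ρ f ε := by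
  have hsub := oscStep_subset f ε
  choose ρ hlt hmem hnot using
    exists_rank_of_iterDeriv_eq_empty (iterDeriv_eq_empty_of_rank_le hsub hα h)
  refine ⟨ρ, fun x => ?_, hlt, fun x => ?_⟩
  · have hcl := isClosed_iterDeriv (isClosed_oscStep f ε) isClosed_univ (ρ x + 1)
    filter_upwards [hcl.isOpen_compl.mem_nhds (hnot x)] with y hy
    by_contra! hlt
    exact hy (iterDeriv_anti hsub _ (Order.add_one_le_of_lt hlt) (hmem y))
  · have hx := hnot x
    rw [iterDeriv_add_one] at hx
    simp only [oscStep, Set.mem_ofPred_eq, not_and, not_forall] at hx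
    obtain ⟨U, hU, hxU, hne⟩ := hx (hmem x)
    filter_upwards [hU.mem_nhds hxU] with y hy hρ
    by_contra! hge
    exact hne ⟨y, ⟨hy, hρ ▸ hmem y⟩, x, ⟨hxU, hmem x⟩, hge⟩

/-- Near a point of `P` of least rank, semicontinuity forces all of `P` into a single level. -/
theorem oscIndex_le_of_levelOscLT {X : Type*} [TopologicalSpace X] {g : X → ℝ}
    {ρ : X → Ordinal.{0}} (hρ : IsUpperRank ρ) (hg : ∀ ε > 0, LevelOscLT ρ g ε)
    {α : Ordinal.{0}} (hα : α < ω₁) (hlt : ∀ x, ρ x < α) : oscIndex Set.univ g ≤ α := by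
  rw [oscIndex_le_iff]
  intro ε hε
  refine rank_le_of_rank_function ρ hα hlt fun P x hx => ?_
  by_contra! hmin
  have hnear := (hρ x).and (hg (ε / 2) (half_pos hε) x)
  obtain ⟨U, hUs, hU, hxU⟩ := eventually_nhds_iff.1 hnear
  obtain ⟨y, ⟨hyU, hyP⟩, z, ⟨hzU, hzP⟩, hyz⟩ := hx.2 U hU hxU
  have h₁ := (hUs y hyU).2 ((hUs y hyU).1.antisymm (hmin y hyP))
  have h₂ := (hUs z hzU).2 ((hUs z hzU).1.antisymm (hmin z hzP))
  rw [abs_lt] at h₁ h₂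
  rw [le_abs] at hyz
  rcases hyz with h | h <;> linarith

theorem rank_convStep_le {X : Type*} [TopologicalSpace X] {g : ℕ → X → ℝ} {ε : ℝ}
    {ρ : X → Ordinal.{0}} (hρ : IsUpperRank ρ) {α : Ordinal.{0}} (hα : α < ω₁)
    (hlt : ∀ x, ρ x < α)
    (hg : ∀ x, ∃ m : ℕ, ∀ᶠ y in 𝓝 x, ρ y = ρ x → ∀ n₁ > m, ∀ n₂ > m,
      |g n₁ y - g n₂ y| < ε) : rank (convStep g ε) Set.univ ≤ α := by
  refine rank_le_of_rank_function ρ hα hlt fun P x hx => ?_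
  by_contra! hmin
  obtain ⟨m, hm⟩ := hg x
  obtain ⟨U, hUs, hU, hxU⟩ := eventually_nhds_iff.1 ((hρ x).and hm)
  obtain ⟨n₁, n₂, h₁₂, h₂, y, ⟨hyU, hyP⟩, hge⟩ := hx.2 U hU hxU m
  exact hge.not_gt ((hUs y hyU).2 ((hUs y hyU).1.antisymm (hmin y hyP)) n₁ (h₂.trans h₁₂) n₂ h₂)

/-! ### Combining ranks -/

/-- Near `x` no rank exceeds its value at `x`, so by strict monotonicity equal natural sums force
equal summands. -/
theorem exists_common_isUpperRank {X : Type*} [TopologicalSpace X] (ξ : Ordinal.{0})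
    (r : ℕ → X → Ordinal.{0}) (hr : ∀ k, IsUpperRank (r k)) (hlt : ∀ k x, r k x < ω ^ ξ)
    (n : ℕ) :
    ∃ R : X → Ordinal.{0}, IsUpperRank R ∧ (∀ x, R x < ω ^ ξ) ∧
      ∀ x, ∀ᶠ y in 𝓝 x, R y = R x → ∀ k ≤ n, r k y = r k x := by
  induction n with
  | zero =>
    exact ⟨r 0, hr 0, hlt 0, fun x => Eventually.of_forall fun y h k hk => by
      rwa [Nat.le_zero.1 hk]⟩
  | succ n ih =>
    obtain ⟨R, hR, hRlt, hRr⟩ := ih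
    refine ⟨fun x => natSum (R x) (r (n + 1) x), fun x => ?_, fun x => ?_, fun x => ?_⟩
    · filter_upwards [hR x, hr (n + 1) x] with y h₁ h₂ using natSum_mono h₁ h₂
    · exact natSum_lt_omega0_opow ξ _ (hRlt x) _ (hlt _ x)
    · filter_upwards [hR x, hr (n + 1) x, hRr x] with y h₁ h₂ h₃ heq k hk
      obtain ⟨e₁, e₂⟩ := eq_of_natSum_eq h₁ h₂ heq
      rcases Nat.le_succ_iff.1 hk with hk | rfl
      · exact h₃ e₁ k hk
      · exact e₂

/-! ### Approximation on the stable sets of finitely many ranks -/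

/-- The points at which `η` attains its maximum over the ball of radius `δ`. -/
def stableSet {X : Type*} [MetricSpace X] (η : X → Ordinal.{0}) (δ : ℝ) : Set X :=
  {x | ∀ y, dist x y < δ → η y ≤ η x}

theorem eq_of_mem_stableSet {X : Type*} [MetricSpace X] {η : X → Ordinal.{0}} {δ : ℝ} {x y : X}
    (hx : x ∈ stableSet η δ) (hy : y ∈ stableSet η δ) (h : dist x y < δ) : η y = η x :=
  (hx y h).antisymm (hy x (by rwa [dist_comm]))

theorem isClosed_stableSet {X : Type*} [MetricSpace X] {η : X → Ordinal.{0}}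
    (hη : IsUpperRank η) {δ : ℝ} (hδ : 0 < δ) : IsClosed (stableSet η δ) := by
  refine isClosed_of_closure_subset fun x hx y hxy => ?_
  have h₁ : ∀ᶠ z in 𝓝 x, dist z y < δ :=
    (continuous_id.dist continuous_const).continuousAt.eventually_lt_const hxy
  have h₂ : ∀ᶠ z in 𝓝 x, dist z x < δ := Metric.ball_mem_nhds x hδ
  obtain ⟨z, hz, ⟨hz₁, hz₂⟩, hz₃⟩ :=
    ((mem_closure_iff_frequently.1 hx).and_eventually ((h₁.and h₂).and (hη x))).exists
  exact (hz y hz₁).trans hz₃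

theorem mem_stableSet_of_eventually {X : Type*} [MetricSpace X] {η : X → Ordinal.{0}}
    (hη : IsUpperRank η) (x : X) :
    ∃ m : ℕ, ∀ᶠ y in 𝓝 x, η y = η x → ∀ n ≥ m, y ∈ stableSet η (1 / ((n : ℝ) + 1)) := by
  obtain ⟨r, hr, hball⟩ := Metric.eventually_nhds_iff.1 (hη x)
  -- Half the radius, so that small balls around nearby `y` stay where `η ≤ η x`.
  obtain ⟨m, hm⟩ := exists_nat_one_div_lt (half_pos hr)
  refine ⟨m, ?_⟩
  filter_upwards [Metric.ball_mem_nhds x (half_pos hr)] with y hy hyx n hn z hz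
  rw [hyx]
  apply hball
  have h₁ : (1 : ℝ) / (n + 1) ≤ 1 / (m + 1) := Nat.one_div_le_one_div hn
  calc dist z x ≤ dist z y + dist y x := dist_triangle _ _ _
    _ < r / 2 + r / 2 := by
      have := Metric.mem_ball.1 hy
      rw [dist_comm z y]
      linarith
    _ = r := add_halves r

open scoped Classical in
/-- The remainder of `ρ` modulo `c`, restricted to the stable set of its quotient by `c`. -/
noncomputable def stableMod {X : Type*} [MetricSpace X] (ρ : X → Ordinal.{0}) (c : Ordinal.{0})
    (δ : ℝ) (x : X) : Ordinal.{0} :=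
  if x ∈ stableSet (fun y => ρ y / c) δ then ρ x % c else 0

/-- Stable points within `δ` share their quotient, so comparing ranks compares remainders. The value
`0` elsewhere is harmless because the stable set is closed. -/
theorem isUpperRank_stableMod {X : Type*} [MetricSpace X] {ρ : X → Ordinal.{0}}
    (hρ : IsUpperRank ρ) (c : Ordinal.{0}) {δ : ℝ} (hδ : 0 < δ) :
    IsUpperRank (stableMod ρ c δ) := by
  intro x
  by_cases hx : x ∈ stableSet (fun y => ρ y / c) δ
  · filter_upwards [hρ x, Metric.ball_mem_nhds x hδ] with y hy hd
    by_cases hyA : y ∈ stableSet (fun y => ρ y / c) δ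
    · simp only [stableMod, if_pos hx, if_pos hyA]
      have heq : ρ y / c = ρ x / c :=
        eq_of_mem_stableSet hx hyA (by rw [dist_comm]; exact hd)
      rw [← Ordinal.div_add_mod (ρ y) c, ← Ordinal.div_add_mod (ρ x) c, heq] at hy
      exact le_of_add_le_add_left hy
    · simp [stableMod, if_neg hyA]
  · filter_upwards [(isClosed_stableSet (hρ.div c) hδ).isOpen_compl.mem_nhds hx] with y hy
    simp [stableMod, if_neg (show y ∉ stableSet (fun y => ρ y / c) δ from hy)]

theorem stableMod_lt {X : Type*} [MetricSpace X] (ρ : X → Ordinal.{0}) {c : Ordinal.{0}}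
    (hc : c ≠ 0) (δ : ℝ) (x : X) : stableMod ρ c δ x < c := by
  unfold stableMod
  split_ifs
  · exact Ordinal.mod_lt _ hc
  · exact pos_iff_ne_zero.2 hc

theorem eventually_abs_sub_lt_of_stableMod_eq {X : Type*} [MetricSpace X] {ρ : X → Ordinal.{0}}
    (hρ : IsUpperRank ρ) (c : Ordinal.{0}) {δ ε : ℝ} (hδ : 0 < δ) {f : X → ℝ}
    (hf : LevelOscLT ρ f ε) (x : X) :
    ∀ᶠ y in 𝓝 x, stableMod ρ c δ y = stableMod ρ c δ x →
      y ∈ stableSet (fun y => ρ y / c) δ → |f y - f x| < ε := by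
  by_cases hx : x ∈ stableSet (fun y => ρ y / c) δ
  · filter_upwards [hf x, Metric.ball_mem_nhds x hδ] with y hy hd hmod hyA
    simp only [stableMod, if_pos hx, if_pos hyA] at hmod
    have heq : ρ y / c = ρ x / c := eq_of_mem_stableSet hx hyA (by rw [dist_comm]; exact hd)
    exact hy (by rw [← Ordinal.div_add_mod (ρ y) c, ← Ordinal.div_add_mod (ρ x) c, heq, hmod])
  · filter_upwards [(isClosed_stableSet (hρ.div c) hδ).isOpen_compl.mem_nhds hx] with y hy _ hyA
    exact absurd hyA hy

/-! ### Continuous selections on levels, and gluing -/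

theorem exists_continuousOn_of_local_const {X : Type*} [MetricSpace X] (S : Set X)
    (t : X → Set ℝ) (ht : ∀ x, Convex ℝ (t x))
    (h : ∀ x ∈ S, ∃ c, ∀ᶠ y in 𝓝 x, y ∈ S → c ∈ t y) :
    ∃ g : X → ℝ, ContinuousOn g S ∧ ∀ x ∈ S, g x ∈ t x := by
  classical
  obtain ⟨g, hg⟩ := exists_continuous_forall_mem_convex_of_local_const (X := S) (E := ℝ)
    (t := fun x => t x) (fun x => ht x) (fun x => by
      obtain ⟨c, hc⟩ := h x x.2
      refine ⟨c, ?_⟩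
      rw [nhds_subtype_eq_comap]
      exact (hc.comap _).mono fun y hy => hy y.2)
  have hval : ∀ x (hx : x ∈ S), (fun y => if hy : y ∈ S then g ⟨y, hy⟩ else 0) x = g ⟨x, hx⟩ :=
    fun x hx => dif_pos hx
  refine ⟨fun y => if hy : y ∈ S then g ⟨y, hy⟩ else 0, ?_, fun x hx => ?_⟩
  · rw [continuousOn_iff_continuous_domRestrict]
    convert g.continuous using 1
    funext x
    exact hval x x.2
  · rw [hval x hx]
    exact hg ⟨x, hx⟩

theorem exists_approx_on_stableSets {X : Type*} [MetricSpace X] {f : X → ℝ} {ε : ℕ → ℝ}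
    {ρ : ℕ → X → Ordinal.{0}} (hρ : ∀ k, IsUpperRank (ρ k))
    (hf : ∀ k, LevelOscLT (ρ k) f (ε k)) (ξ : Ordinal.{0}) (n : ℕ) {δ : ℝ} (hδ : 0 < δ) :
    ∃ (g : X → ℝ) (R : X → Ordinal.{0}), IsUpperRank R ∧ (∀ x, R x < ω ^ ξ) ∧
      (∀ ε' > 0, LevelOscLT R g ε') ∧
      ∀ k ≤ n, ∀ x ∈ stableSet (fun y => ρ k y / ω ^ ξ) δ, |g x - f x| < ε k := by
  obtain ⟨R, hR, hRlt, hRr⟩ := exists_common_isUpperRank ξ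
    (fun k => stableMod (ρ k) (ω ^ ξ) δ) (fun k => isUpperRank_stableMod (hρ k) _ hδ)
    (fun k => stableMod_lt (ρ k) (Ordinal.opow_ne_zero _ Ordinal.omega0_ne_zero) δ) n
  have hlevel : ∀ σ : Ordinal.{0}, ∃ g : X → ℝ, ContinuousOn g {x | R x = σ} ∧
      ∀ x ∈ {x | R x = σ}, g x ∈ ⋂ (k : ℕ) (_ : k ≤ n)
        (_ : x ∈ stableSet (fun y => ρ k y / ω ^ ξ) δ), Metric.ball (f x) (ε k) := by
    intro σ
    -- The constant `f x` is a local selection near `x`.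
    refine exists_continuousOn_of_local_const _ _ (fun x => ?_) fun x hx => ⟨f x, ?_⟩
    · exact convex_iInter fun k => convex_iInter fun _ => convex_iInter fun _ => convex_ball _ _
    · have hall : ∀ᶠ y in 𝓝 x, ∀ k ∈ Finset.range (n + 1),
          stableMod (ρ k) (ω ^ ξ) δ y = stableMod (ρ k) (ω ^ ξ) δ x →
          y ∈ stableSet (fun y => ρ k y / ω ^ ξ) δ → |f y - f x| < ε k :=
        (Finset.eventually_all _).2 fun k _ =>
          eventually_abs_sub_lt_of_stableMod_eq (hρ k) _ hδ (hf k) x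
      filter_upwards [hall, hRr x] with y hy hyR hyσ
      simp only [Set.mem_iInter, Metric.mem_ball]
      intro k hk hyA
      rw [dist_comm, Real.dist_eq]
      refine hy k (Finset.mem_range_succ_iff.2 hk) (hyR ?_ k hk) hyA
      exact Eq.trans hyσ (Eq.symm hx)
  choose G hGc hGmem using hlevel
  refine ⟨fun x => G (R x) x, R, hR, hRlt, fun ε' hε' x => ?_, fun k hk x hx => ?_⟩
  · have h := Metric.tendsto_nhds.1 (hGc (R x) x rfl) ε' hε'
    filter_upwards [eventually_nhdsWithin_iff.1 h] with y hy hyx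
    rw [hyx, ← Real.dist_eq]
    exact hy hyx
  · have h := hGmem (R x) x rfl
    simp only [Set.mem_iInter, Metric.mem_ball] at h
    rw [← Real.dist_eq]
    exact h k hk hx

theorem exists_approximating_sequence {X : Type*} [MetricSpace X] {f : X → ℝ} {ε : ℕ → ℝ}
    {ρ : ℕ → X → Ordinal.{0}} (hρ : ∀ k, IsUpperRank (ρ k))
    (hf : ∀ k, LevelOscLT (ρ k) f (ε k)) (ξ : Ordinal.{0}) :
    ∃ g : ℕ → X → ℝ,
      (∀ n, ∃ R : X → Ordinal.{0}, IsUpperRank R ∧ (∀ x, R x < ω ^ ξ) ∧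
        ∀ ε' > 0, LevelOscLT R (g n) ε') ∧
      ∀ k x, ∃ m : ℕ, ∀ᶠ y in 𝓝 x, ρ k y / ω ^ ξ = ρ k x / ω ^ ξ →
        ∀ n ≥ m, |g n y - f y| < ε k := by
  choose g R hR hlt hcont happrox using fun n : ℕ =>
    exists_approx_on_stableSets hρ hf ξ n (δ := 1 / ((n : ℝ) + 1)) (by positivity)
  refine ⟨g, fun n => ⟨R n, hR n, hlt n, hcont n⟩, fun k x => ?_⟩
  obtain ⟨m, hm⟩ := mem_stableSet_of_eventually ((hρ k).div (ω ^ ξ)) x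
  refine ⟨max m k, hm.mono fun y hy hyx n hn => ?_⟩
  exact happrox n k (le_of_max_le_right hn) y (hy hyx n (le_of_max_le_left hn))

/-- With exponent `0` the approximants have ranks below `ω^0 = 1`, a single level, so they are
continuous. -/
theorem isBaireOne_of_levelOscLT {X : Type*} [MetricSpace X] {f : X → ℝ} {ρ : X → Ordinal.{0}}
    (hρ : IsUpperRank ρ) (hf : ∀ ε > 0, LevelOscLT ρ f ε) : IsBaireOne f := by
  obtain ⟨g, hg, happrox⟩ := exists_approximating_sequence (ρ := fun _ => ρ)
    (ε := fun k => 1 / ((k : ℝ) + 1)) (fun _ => hρ) (fun k => hf _ (by positivity)) 0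
  refine ⟨g, fun n => ?_, fun x => Metric.tendsto_atTop.2 fun ε hε => ?_⟩
  · obtain ⟨R, -, hlt, hcont⟩ := hg n
    simp only [Ordinal.opow_zero, Order.lt_one_iff] at hlt
    refine continuous_iff_continuousAt.2 fun x => Metric.tendsto_nhds.2 fun ε hε => ?_
    filter_upwards [hcont ε hε x] with y hy
    exact hy (by rw [hlt, hlt])
  · obtain ⟨k, hk⟩ := exists_nat_one_div_lt hε
    obtain ⟨m, hm⟩ := happrox k x
    exact ⟨m, fun n hn => (hm.self_of_nhds rfl n hn).trans hk⟩

theorem convIndex_const_le_one {X : Type*} [TopologicalSpace X] (f : X → ℝ) :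
    convIndex Set.univ (fun _ : ℕ => f) ≤ 1 := by
  have h1 : (1 : Ordinal.{0}) < ω₁ := Ordinal.one_lt_omega0.trans Ordinal.omega0_lt_omega_one
  rw [convIndex_le_iff]
  exact fun ε hε => rank_convStep_le (ρ := fun _ => 0)
    (fun x => Eventually.of_forall fun _ => le_rfl) h1 (fun _ => zero_lt_one)
    fun x => ⟨0, Eventually.of_forall fun y _ n₁ _ n₂ _ => by simpa using hε⟩

/-- Only the leading power of `a` matters: its finite coefficient is absorbed by a factor `ω`, which
needs `b ≠ 0`. -/
theorem mul_omega0_opow_le {a b : Ordinal.{0}} (hb : b ≠ 0) :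
    a * ω ^ b ≤ ω ^ Ordinal.log ω a * ω ^ b := by
  obtain ⟨n, hn⟩ := Ordinal.lt_omega0.1 (Ordinal.div_opow_log_lt a Ordinal.one_lt_omega0)
  have hle : a ≤ ω ^ Ordinal.log ω a * ((n + 1 : ℕ) : Ordinal) := by
    rw [Nat.cast_add_one, ← hn]
    exact (Ordinal.lt_mul_succ_div a (Ordinal.opow_ne_zero _ Ordinal.omega0_ne_zero)).le
  have hb' : (ω : Ordinal.{0}) ^ b = ω * ω ^ (b - 1) := by
    conv_lhs => rw [← Ordinal.add_sub_cancel_of_le (Order.one_le_iff_ne_zero.2 hb),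
      Ordinal.opow_add, Ordinal.opow_one]
  calc a * ω ^ b ≤ ω ^ Ordinal.log ω a * ((n + 1 : ℕ) : Ordinal) * ω ^ b := by gcongr
    _ = ω ^ Ordinal.log ω a * ω ^ b := by
      rw [hb', mul_assoc, ← mul_assoc (((n + 1 : ℕ) : Ordinal)),
        Ordinal.natCast_mul_omega0 n.succ_pos]

end BaireIndex

theorem theorem11 {K : Type*} [MetricSpace K] [CompactSpace K] (f : K → ℝ)
    (hf : BaireIndex.IsBaireOne f) (β₀ γ₀ : Ordinal.{0}) (hβ₁ : 1 ≤ β₀) (hβ₂ : β₀ < ω₁)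
    (hγ : γ₀ < ω₁) (hfβ : BaireIndex.oscIndex Set.univ f ≤ β₀ * ω ^ γ₀) :
    ∃ g : ℕ → K → ℝ,
      (∀ n, BaireIndex.IsBaireOne (g n)) ∧
      (∀ x, Tendsto (fun n => g n x) atTop (𝓝 (f x))) ∧
      (∀ n, BaireIndex.oscIndex Set.univ (g n) ≤ β₀) ∧
      BaireIndex.convIndex Set.univ g ≤ ω ^ γ₀ := by
  -- For `γ₀ = 0` that absorption is unavailable, but the constant sequence `f` works.
  rcases eq_or_ne γ₀ 0 with rfl | hγ0
  · rw [Ordinal.opow_zero, mul_one] at hfβ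
    refine ⟨fun _ => f, fun _ => hf, fun _ => tendsto_const_nhds, fun _ => hfβ, ?_⟩
    rw [Ordinal.opow_zero]
    exact BaireIndex.convIndex_const_le_one f
  have hβ0 : β₀ ≠ 0 := Order.one_le_iff_ne_zero.1 hβ₁
  set ξ := Ordinal.log ω β₀
  have hξ : (ω : Ordinal.{0}) ^ ξ ≤ β₀ := Ordinal.opow_log_le_self _ hβ0
  have hγ₁ : (ω : Ordinal.{0}) ^ γ₀ < ω₁ :=
    Ordinal.isPrincipal_opow_omega 1 Ordinal.omega0_lt_omega_one hγ
  have hprod : (ω : Ordinal.{0}) ^ ξ * ω ^ γ₀ < ω₁ :=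
    Ordinal.isPrincipal_mul_omega 1 (hξ.trans_lt hβ₂) hγ₁
  have hosc := (BaireIndex.oscIndex_le_iff _ _ _).1
    (hfβ.trans (BaireIndex.mul_omega0_opow_le hγ0))
  choose ρ hρ hρlt hρf using fun k : ℕ =>
    BaireIndex.exists_isUpperRank_of_rank_oscStep_le hprod
      (hosc (1 / ((k : ℝ) + 1)) (by positivity))
  obtain ⟨g, hg, happrox⟩ := BaireIndex.exists_approximating_sequence hρ hρf ξ
  refine ⟨g, fun n => ?_, fun x => Metric.tendsto_atTop.2 fun ε hε => ?_, fun n => ?_, ?_⟩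
  · obtain ⟨R, hR, -, hRg⟩ := hg n
    exact BaireIndex.isBaireOne_of_levelOscLT hR hRg
  · obtain ⟨k, hk⟩ := exists_nat_one_div_lt hε
    obtain ⟨m, hm⟩ := happrox k x
    exact ⟨m, fun n hn => (hm.self_of_nhds rfl n hn).trans hk⟩
  · obtain ⟨R, hR, hRlt, hRg⟩ := hg n
    exact BaireIndex.oscIndex_le_of_levelOscLT hR hRg hβ₂ fun x => (hRlt x).trans_le hξ
  · rw [BaireIndex.convIndex_le_iff]
    intro ε hε
    obtain ⟨k, hk⟩ := exists_nat_one_div_lt (half_pos hε)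
    have hne : (ω : Ordinal.{0}) ^ ξ ≠ 0 := Ordinal.opow_ne_zero _ Ordinal.omega0_ne_zero
    refine BaireIndex.rank_convStep_le ((hρ k).div (ω ^ ξ)) hγ₁
      (fun x => (Ordinal.lt_mul_iff_div_lt hne).1 (hρlt k x)) fun x => ?_
    obtain ⟨m, hm⟩ := happrox k x
    refine ⟨m, hm.mono fun y hy hyx n₁ h₁ n₂ h₂ => ?_⟩
    have e₁ := abs_lt.1 (hy hyx n₁ h₁.le)
    have e₂ := abs_lt.1 (hy hyx n₂ h₂.le)
    rw [abs_lt]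
    constructor <;> linarith [e₁.1, e₁.2, e₂.1, e₂.2]
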